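/- **Setting.** Let $X=\{0,1\}^{\mathbb N}$ with the product Bernoulli measure $\mu=\bigotimes_{\mathbb N}\frac12(\delta_0+\delta_1)$, and let $\mathcal R_0$ be the relation on $X$ of equality up to finitely many coordinates. Let $[\mathcal R_0]$ be its full group, i.e. the group of all measure-preserving Borel bijections $T$ of $X$ with $T(x)\,\mathcal R_0\,x$ for almost every $x$, two such bijections being identified if they coincide almost everywhere, equipped with the metric $d_u(S,T)=\mu(\{x: S(x)\ne T(x)\})$. Write $\operatorname{supp}T=\{x:T(x)\neq x\}$. A permutation $\sigma$ of $\{0,1\}^n$ acts on $X$ by $s\smallfrown x\mapsto\sigma(s)\smallfrown x$ ($s\in\{0,1\}^n$); let $\widetilde{\mathfrak S}_{\{0,1\}^n}\le[\mathcal R_0]$ be the group of the transformations so obtained. Let $T_0\in[\mathcal R_0]$ be the odometer, $1^m0\smallfrown x\mapsto 0^m1\smallfrown x$ for $m\geq 0$ (defined almost everywhere), and for $n\ge2$ let $U_n\in\widetilde{\mathfrak S}_{\{0,1\}^n}$ be given by the transposition of $\{0,1\}^n$ which exchanges $0^{n-1}1$ and $1^{n-1}0$. By a $2^k$-th root $\sqrt[2^k]{U_n}$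 of $U_n$ we mean any element of $\widetilde{\mathfrak S}_{\{0,1\}^{n+k}}$ whose $2^k$-th power is $U_n$ and whose support is $\operatorname{supp}U_n$ (such roots exist). If $A$ is a Borel set invariant under $T$ (i.e. $T^{-1}(A)=A$), let $T_A$ be the transformation which equals $T$ on $A$ and the identity off $A$. **Theorem.** For every $\epsilon>0$ there exist a strictly increasing sequence $(n_k)_{k\ge0}$ of integers $n_k\ge2$ and a sequence $(\delta_k)_{k\geq 0}$ of positive reals with the following property. For all choices of $2^k$-th roots $\sqrt[2^k]{U_{n_k}}$ and of Borel sets $B_k\subseteq\operatorname{supp}U_{n_k}$ ($k\ge0$) such that, for every $k$, $B_k$ is $\sqrt[2^k]{U_{n_k}}$-invariant and $$\mu(B_k)>\mu(\operatorname{supp}U_{n_k})-\delta_k,$$ the infinite product $$U:=\prod_{k=0}^{+\infty}\bigl(\sqrt[2^k]{U_{n_k}}\bigr)_{B_k}$$ converges in $([\mathcal R_0],d_u)$, the set $\{T_0,U\}$ generates a dense subgroup of $[\mathcal R_0]$, and $\mu(\operatorname{supp}U)<\epsilon$. -/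

import Mathlib

open Set Filter Topology MeasureTheory
open scoped ENNReal

namespace DyadicFullGroup

/-! ### Full groups -/

section General

variable {X : Type*} [MeasurableSpace X]

/-- Representatives of the elements of the full group of the equivalence relation `R`: the
measurable bijections `T` with measurable inverse which preserve `μ` and satisfy `T x R x` for
almost every `x`. Elements which agree almost everywhere are identified in `FullGroup` below. -/
def PreFullGroup (μ : Measure X) (R : Setoid X) : Subgroup (Equiv.Perm X) where
  carrier := {T | MeasurePreserving (T : X → X) μ μ ∧ MeasurePreserving (T.symm : X → X) μ μ ∧
    ∀ᵐ x ∂μ, R (T x) x}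
  mul_mem' := by
    rintro S T ⟨hS, hS', hSR⟩ ⟨hT, hT', hTR⟩
    refine ⟨hS.comp hT, hT'.comp hS', ?_⟩
    filter_upwards [hT.quasiMeasurePreserving.ae hSR, hTR] with x h1 h2
    exact R.trans h1 h2
  one_mem' := ⟨MeasurePreserving.id μ, MeasurePreserving.id μ, ae_of_all _ fun x => R.refl x⟩
  inv_mem' := by
    rintro T ⟨hT, hT', hTR⟩
    refine ⟨hT', hT, ?_⟩
    filter_upwards [hT'.quasiMeasurePreserving.ae hTR] with x h
    rw [Equiv.apply_symm_apply] at h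
    exact R.symm h

variable {μ : Measure X} {R : Setoid X}

/-- The support of a transformation. -/
def supp (T : PreFullGroup μ R) : Set X := {x | (T : Equiv.Perm X) x ≠ x}

/-- The uniform distance `d_u(S, T) = μ {x | S x ≠ T x}`. -/
noncomputable instance [IsFiniteMeasure μ] : PseudoMetricSpace (PreFullGroup μ R) where
  dist S T := μ.real {x | (S : Equiv.Perm X) x ≠ (T : Equiv.Perm X) x}
  dist_self S := by simp
  dist_comm S T := by simp only [ne_comm]
  dist_triangle S T V := by
    refine (measureReal_mono ?_).trans (measureReal_union_le _ _)
    intro x hx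
    by_contra h
    simp only [mem_union, mem_ofPred_eq, not_or, not_not] at h
    exact hx (h.1.trans h.2)

theorem dist_def [IsFiniteMeasure μ] (S T : PreFullGroup μ R) :
    dist S T = μ.real {x | (S : Equiv.Perm X) x ≠ (T : Equiv.Perm X) x} := rfl

theorem dist_mul_left [IsFiniteMeasure μ] (V S T : PreFullGroup μ R) :
    dist (V * S) (V * T) = dist S T := by
  simp [dist_def]

theorem dist_mul_right [IsFiniteMeasure μ] (V S T : PreFullGroup μ R) :
    dist (S * V) (T * V) = dist S T := by
  have hV : MeasurePreserving (MeasurableEquiv.mk (V : Equiv.Perm X) V.2.1.measurable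
    V.2.2.1.measurable) μ μ := V.2.1
  simp only [dist_def, measureReal_def]
  congr 1
  exact hV.measure_preimage_equiv {x | (S : Equiv.Perm X) x ≠ (T : Equiv.Perm X) x}

instance [IsFiniteMeasure μ] : IsTopologicalGroup (PreFullGroup μ R) where
  continuous_mul := by
    rw [Metric.continuous_iff]
    rintro ⟨S, T⟩ ε hε
    refine ⟨ε / 2, by positivity, ?_⟩
    rintro ⟨S', T'⟩ h
    rw [Prod.dist_eq, max_lt_iff] at h
    have h1 := dist_triangle (S' * T') (S * T') (S * T)
    rw [dist_mul_right, dist_mul_left] at h1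
    have h2 := h.1
    have h3 := h.2
    dsimp only at h2 h3 ⊢
    linarith
  continuous_inv := by
    have h : Isometry fun S : PreFullGroup μ R => S⁻¹ := by
      refine Isometry.of_dist_eq fun S T => ?_
      rw [← dist_mul_left S, ← dist_mul_right T]
      simp [dist_comm]
    exact h.continuous

/-- The full group `[R]`: elements which coincide almost everywhere, that is, are at uniform
distance zero, are identified. It is a topological group for the metric `d_u`. -/
abbrev FullGroup (μ : Measure X) [IsFiniteMeasure μ] (R : Setoid X) : Type _ :=
  SeparationQuotient (PreFullGroup μ R)

/-- The class of a transformation modulo almost everywhere equality. -/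
noncomputable abbrev toFull [IsFiniteMeasure μ] (T : PreFullGroup μ R) : FullGroup μ R :=
  SeparationQuotient.mk T

theorem toFull_eq_iff [IsFiniteMeasure μ] (S T : PreFullGroup μ R) :
    toFull S = toFull T ↔ (S : Equiv.Perm X) =ᵐ[μ] (T : Equiv.Perm X) := by
  rw [SeparationQuotient.mk_eq_mk, Metric.inseparable_iff, dist_def,
    measureReal_eq_zero_iff]
  rfl

open Classical in
/-- The transformation `T_A` induced by `T` on a `T`-invariant measurable set `A`: it is `T` on `A`
and the identity elsewhere. -/
noncomputable def induced (T : PreFullGroup μ R) (A : Set X) (hA : MeasurableSet A)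
    (hTA : (T : Equiv.Perm X) ⁻¹' A = A) : PreFullGroup μ R :=
  ⟨{ toFun := fun x => if x ∈ A then (T : Equiv.Perm X) x else x
     invFun := fun x => if x ∈ A then (T : Equiv.Perm X).symm x else x
     left_inv := by
       intro x
       have h : (T : Equiv.Perm X) x ∈ A ↔ x ∈ A := by rw [← mem_preimage, hTA]
       by_cases hx : x ∈ A <;> simp [hx, h]
     right_inv := by
       intro x
       have h : (T : Equiv.Perm X).symm x ∈ A ↔ x ∈ A := by
         conv_lhs => rw [← hTA]
         simp
       by_cases hx : x ∈ A <;> simp [hx, h] }, by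
    have key : ∀ S : Equiv.Perm X, MeasurePreserving (S : X → X) μ μ → (S : X → X) ⁻¹' A = A →
        MeasurePreserving (fun x => if x ∈ A then S x else x) μ μ := by
      intro S hS hSA
      have hm : Measurable (fun x => if x ∈ A then S x else x) :=
        Measurable.ite hA hS.measurable measurable_id
      refine ⟨hm, ?_⟩
      ext s hs
      rw [Measure.map_apply hm hs]
      have e : (fun x => if x ∈ A then S x else x) ⁻¹' s = S ⁻¹' (s ∩ A) ∪ (s \ A) := by
        ext x
        have h : S x ∈ A ↔ x ∈ A := by rw [← mem_preimage, hSA]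
        by_cases hx : x ∈ A <;> simp [hx, h]
      rw [e, measure_union _ (hs.diff hA), hS.measure_preimage (hs.inter hA).nullMeasurableSet,
        measure_inter_add_sdiff s hA]
      rw [preimage_inter, hSA]
      exact disjoint_sdiff_right.mono_left inter_subset_right
    have hTA' : ((T : Equiv.Perm X).symm : X → X) ⁻¹' A = A := by
      conv_lhs => rw [← hTA]
      ext x
      simp
    refine ⟨key _ T.2.1 hTA, key _ T.2.2.1 hTA', ?_⟩
    filter_upwards [T.2.2.2] with x hx
    change R (if x ∈ A then (T : Equiv.Perm X) x else x) x
    split_ifs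
    exacts [hx, R.refl x]⟩

end General

/-! ### The space of binary sequences and the relation `R₀` -/

/-- The fair coin `(δ₀ + δ₁) / 2` on `{0, 1}`, with `0 = false` and `1 = true`. -/
noncomputable def coin : Measure Bool := (2⁻¹ : ℝ≥0∞) • (Measure.dirac false + Measure.dirac true)

instance : IsProbabilityMeasure coin := by
  constructor
  simp only [coin, Measure.smul_apply, Measure.add_apply, measure_univ, smul_eq_mul]
  rw [one_add_one_eq_two]
  exact ENNReal.inv_mul_cancel (by simp) (by simp)

theorem coin_singleton (b : Bool) : coin {b} = 2⁻¹ := by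
  cases b <;> simp [coin]

/-- The product Bernoulli measure on `{0, 1}^ℕ`. -/
noncomputable def cantorMeasure : Measure (ℕ → Bool) := Measure.infinitePi fun _ => coin

instance : IsProbabilityMeasure cantorMeasure := by unfold cantorMeasure; infer_instance

/-- Two sequences are `R₀`-equivalent if they agree from some index on. -/
def R₀ : Setoid (ℕ → Bool) where
  r x y := ∃ N, ∀ i, N ≤ i → x i = y i
  iseqv :=
    { refl := fun _ => ⟨0, fun _ _ => rfl⟩
      symm := fun ⟨N, h⟩ => ⟨N, fun i hi => (h i hi).symm⟩
      trans := fun ⟨N, h⟩ ⟨M, k⟩ => ⟨max N M, fun i hi =>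
        (h i (le_of_max_le_left hi)).trans (k i (le_of_max_le_right hi))⟩ }

/-- The set of sequences which agree with `y` before the index `N`. -/
def cyl (y : ℕ → Bool) (N : ℕ) : Set (ℕ → Bool) := {x | ∀ i < N, x i = y i}

theorem cyl_eq_pi (y : ℕ → Bool) (N : ℕ) :
    cyl y N = Set.pi (Finset.range N : Set ℕ) fun i => {y i} := by
  ext x
  simp [cyl, Set.mem_pi]

theorem measurableSet_cyl (y : ℕ → Bool) (N : ℕ) : MeasurableSet (cyl y N) := by
  rw [cyl_eq_pi]
  exact MeasurableSet.pi (Finset.countable_toSet _) fun i _ => measurableSet_singleton _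

theorem cantorMeasure_cyl (y : ℕ → Bool) (N : ℕ) : cantorMeasure (cyl y N) = 2⁻¹ ^ N := by
  rw [cyl_eq_pi, cantorMeasure, Measure.infinitePi_pi _ fun i _ => measurableSet_singleton _]
  simp [coin_singleton]

theorem generateFrom_cyl (n : ℕ) :
    (inferInstance : MeasurableSpace (ℕ → Bool)) =
      MeasurableSpace.generateFrom {s | ∃ y, ∃ N ≥ n, s = cyl y N} := by
  apply le_antisymm
  · refine iSup_le fun i => ?_
    rw [← measurable_iff_comap_le]
    refine @measurable_to_bool _ (MeasurableSpace.generateFrom _) _ ?_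
    have e : (fun x : ℕ → Bool => x i) ⁻¹' {true} =
        ⋃ a : {a : Fin (max n (i + 1)) → Bool // a ⟨i, by omega⟩ = true},
          cyl (fun j => if h : j < max n (i + 1) then a.1 ⟨j, h⟩ else false) (max n (i + 1)) := by
      ext x
      simp only [mem_preimage, mem_singleton_iff, mem_iUnion, cyl, mem_ofPred_eq]
      constructor
      · intro hx
        exact ⟨⟨fun j => x j, hx⟩, fun j hj => by simp only [hj, dif_pos]⟩
      · rintro ⟨⟨a, ha⟩, h⟩
        have := h i (by omega)
        rw [dif_pos (by omega : i < max n (i + 1))] at this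
        exact this.trans ha
    rw [e]
    exact @MeasurableSet.iUnion _ _ (MeasurableSpace.generateFrom _) _ _ fun a =>
      MeasurableSpace.measurableSet_generateFrom ⟨_, _, le_max_left _ _, rfl⟩
  · refine MeasurableSpace.generateFrom_le ?_
    rintro s ⟨y, N, -, rfl⟩
    exact measurableSet_cyl y N

theorem isPiSystem_cyl (n : ℕ) :
    IsPiSystem {s | ∃ y : ℕ → Bool, ∃ N ≥ n, s = cyl y N} := by
  rintro _ ⟨y, N, hN, rfl⟩ _ ⟨z, M, hM, rfl⟩ ⟨w, hw1, hw2⟩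
  refine ⟨w, max N M, le_max_of_le_left hN, ?_⟩
  ext x
  simp only [cyl, mem_inter_iff, mem_ofPred_eq] at hw1 hw2 ⊢
  constructor
  · rintro ⟨h1, h2⟩ i hi
    rcases lt_max_iff.1 hi with hi | hi
    · rw [h1 i hi, hw1 i hi]
    · rw [h2 i hi, hw2 i hi]
  · intro h
    exact ⟨fun i hi => by rw [h i (lt_max_of_lt_left hi), hw1 i hi],
      fun i hi => by rw [h i (lt_max_of_lt_right hi), hw2 i hi]⟩

/-- A bijection which permutes the cylinders of every large level preserves the measure. -/
theorem measurePreserving_of_cyl (T : Equiv.Perm (ℕ → Bool)) (n : ℕ)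
    (h : ∀ N, n ≤ N → ∀ x y, T x ∈ cyl (T y) N ↔ x ∈ cyl y N) :
    MeasurePreserving (T : (ℕ → Bool) → ℕ → Bool) cantorMeasure cantorMeasure := by
  have hpre : ∀ y, ∀ N ≥ n, T ⁻¹' cyl y N = cyl (T.symm y) N := by
    intro y N hN
    ext x
    have := h N hN x (T.symm y)
    rwa [Equiv.apply_symm_apply] at this
  have hm : Measurable (T : (ℕ → Bool) → ℕ → Bool) := by
    have : ∀ s ∈ {s | ∃ y : ℕ → Bool, ∃ N ≥ n, s = cyl y N}, MeasurableSet (T ⁻¹' s) := by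
      rintro s ⟨y, N, hN, rfl⟩
      rw [hpre y N hN]
      exact measurableSet_cyl _ _
    have h2 := measurable_generateFrom this
    rwa [← generateFrom_cyl n] at h2
  refine ⟨hm, ?_⟩
  have : IsProbabilityMeasure (Measure.map T cantorMeasure) :=
    Measure.isProbabilityMeasure_map hm.aemeasurable
  refine ext_of_generate_finite _ (generateFrom_cyl n) (isPiSystem_cyl n) ?_ (by simp)
  rintro s ⟨y, N, hN, rfl⟩
  rw [Measure.map_apply hm (measurableSet_cyl _ _), hpre y N hN, cantorMeasure_cyl, cantorMeasure_cyl]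

theorem mem_preFullGroup (T : Equiv.Perm (ℕ → Bool)) (n : ℕ)
    (h : ∀ N, n ≤ N → ∀ x y, T x ∈ cyl (T y) N ↔ x ∈ cyl y N)
    (hR : ∀ᵐ x ∂cantorMeasure, R₀ (T x) x) : T ∈ PreFullGroup cantorMeasure R₀ := by
  refine ⟨measurePreserving_of_cyl T n h, measurePreserving_of_cyl T.symm n ?_, hR⟩
  intro N hN x y
  have := h N hN (T.symm x) (T.symm y)
  rw [Equiv.apply_symm_apply, Equiv.apply_symm_apply] at this
  exact this.symm

/-! ### The odometer -/

theorem odometer_aux (b : Bool) (x : ℕ → Bool) (i : ℕ) :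
    (∀ j < i, (if ∀ l < j, x l = b then !x j else x j) = !b) ↔ ∀ j < i, x j = b := by
  induction i with
  | zero => simp
  | succ i ih =>
    simp only [Nat.forall_lt_succ_right]
    rw [ih]
    refine and_congr_right fun h => ?_
    rw [if_pos h]
    simp

/-- The odometer on all binary sequences: addition of `(1, 0, 0, …)` with carry to the right. The
`i`-th digit is changed exactly if all the earlier digits are equal to `1`, so that
`1 … 1 0 x` is sent to `0 … 0 1 x`, and the constant sequence `1` to the constant sequence `0`. -/
def odometerPerm : Equiv.Perm (ℕ → Bool) where
  toFun x i := if ∀ j < i, x j = true then !x i else x i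
  invFun x i := if ∀ j < i, x j = false then !x i else x i
  left_inv x := by
    funext i
    have h := odometer_aux true x i
    simp only [Bool.not_true] at h
    simp only [h]
    split_ifs <;> simp
  right_inv x := by
    funext i
    have h := odometer_aux false x i
    simp only [Bool.not_false] at h
    simp only [h]
    split_ifs <;> simp

theorem odometerPerm_apply (x : ℕ → Bool) (i : ℕ) :
    odometerPerm x i = if ∀ j < i, x j = true then !x i else x i := rfl

theorem odometerPerm_symm_apply (x : ℕ → Bool) (i : ℕ) :
    odometerPerm.symm x i = if ∀ j < i, x j = false then !x i else x i := rfl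

/-- The odometer `T₀`, as an element of the full group of `R₀`. -/
def T₀ : PreFullGroup cantorMeasure R₀ :=
  ⟨odometerPerm, by
    refine mem_preFullGroup _ 0 ?_ ?_
    · intro N _ x y
      constructor
      · intro h i hi
        rw [← odometerPerm.symm_apply_apply x, ← odometerPerm.symm_apply_apply y,
          odometerPerm_symm_apply, odometerPerm_symm_apply, h i hi]
        have : (∀ j < i, odometerPerm x j = false) ↔ ∀ j < i, odometerPerm y j = false :=
          forall₂_congr fun j hj => by rw [h j (hj.trans hi)]
        simp only [this]
      · intro h i hi
        rw [odometerPerm_apply, odometerPerm_apply, h i hi]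
        have : (∀ j < i, x j = true) ↔ ∀ j < i, y j = true :=
          forall₂_congr fun j hj => by rw [h j (hj.trans hi)]
        simp only [this]
    · have h0 : cantorMeasure {fun _ => true} = 0 := by
        have hle : ∀ N : ℕ, cantorMeasure {fun _ => true} ≤ 2⁻¹ ^ N := fun N => by
          rw [← cantorMeasure_cyl (fun _ => true) N]
          exact measure_mono (by rintro x rfl i _; rfl)
        have ht : Tendsto (fun N : ℕ => (2⁻¹ : ℝ≥0∞) ^ N) atTop (𝓝 0) :=
          ENNReal.tendsto_pow_atTop_nhds_zero_of_lt_one (by simp)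
        exact le_antisymm (ge_of_tendsto' ht hle) bot_le
      have h1 : ∀ᵐ x ∂cantorMeasure, x ≠ fun _ => true := compl_mem_ae_iff.2 h0
      filter_upwards [h1] with x hx
      obtain ⟨m, hm⟩ := Function.ne_iff.1 hx
      refine ⟨m + 1, fun i hi => ?_⟩
      rw [odometerPerm_apply, if_neg]
      exact fun h => hm (h m (by omega))⟩

/-! ### Dyadic permutations -/

/-- The action of `σ ∈ 𝔖_{{0,1}^n}` on infinite sequences, through their first `n` digits. -/
def dyadicPerm {n : ℕ} (σ : Equiv.Perm (Fin n → Bool)) : Equiv.Perm (ℕ → Bool) where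
  toFun x i := if h : i < n then σ (fun j => x j) ⟨i, h⟩ else x i
  invFun x i := if h : i < n then σ.symm (fun j => x j) ⟨i, h⟩ else x i
  left_inv x := by
    funext i
    by_cases h : i < n <;> simp [h]
  right_inv x := by
    funext i
    by_cases h : i < n <;> simp [h]

theorem dyadicPerm_apply {n : ℕ} (σ : Equiv.Perm (Fin n → Bool)) (x : ℕ → Bool) (i : ℕ) :
    dyadicPerm σ x i = if h : i < n then σ (fun j => x j) ⟨i, h⟩ else x i := rfl

theorem dyadicPerm_symm {n : ℕ} (σ : Equiv.Perm (Fin n → Bool)) :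
    (dyadicPerm σ).symm = dyadicPerm σ.symm := rfl

theorem dyadicPerm_cyl {n : ℕ} (σ : Equiv.Perm (Fin n → Bool)) {N : ℕ} (hN : n ≤ N)
    {x y : ℕ → Bool} (h : x ∈ cyl y N) : dyadicPerm σ x ∈ cyl (dyadicPerm σ y) N := by
  intro i hi
  have : (fun j : Fin n => x j) = fun j : Fin n => y j :=
    funext fun j => h j (j.2.trans_le hN)
  rw [dyadicPerm_apply, dyadicPerm_apply, this, h i hi]

/-- The element of the full group of `R₀` given by `σ ∈ 𝔖_{{0,1}^n}`: `s ⌢ x ↦ σ(s) ⌢ x` for `s` of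
length `n`. -/
def dyadic {n : ℕ} (σ : Equiv.Perm (Fin n → Bool)) : PreFullGroup cantorMeasure R₀ :=
  ⟨dyadicPerm σ, by
    refine mem_preFullGroup _ n ?_ (ae_of_all _ fun x => ⟨n, fun i hi => ?_⟩)
    · refine fun N hN x y => ⟨fun h => ?_, dyadicPerm_cyl σ hN⟩
      have := dyadicPerm_cyl σ.symm hN h
      rwa [← dyadicPerm_symm, Equiv.symm_apply_apply, Equiv.symm_apply_apply] at this
    · rw [dyadicPerm_apply, dif_neg (by omega)]⟩

/-- The transposition `τ_n` of the words `0^{n-1} 1` and `1^{n-1} 0` of length `n`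
(of interest for `n ≥ 2`). -/
def τ (n : ℕ) : Equiv.Perm (Fin n → Bool) :=
  Equiv.swap (fun i => decide (i.val + 1 = n)) (fun i => decide (i.val + 1 ≠ n))

/-- The element `U_n` of the full group of `R₀` given by `τ_n`. -/
def U (n : ℕ) : PreFullGroup cantorMeasure R₀ := dyadic (τ n)

/-- `ρ ∈ 𝔖_{{0,1}^{q+p}}` is a `2^p`-th root of `σ ∈ 𝔖_{{0,1}^q}` with the same support as `σ`,
both being seen as transformations of `{0,1}^ℕ`. -/
structure IsDyadicRoot (p : ℕ) {q : ℕ} (σ : Equiv.Perm (Fin q → Bool))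
    (ρ : Equiv.Perm (Fin (q + p) → Bool)) : Prop where
  pow_eq : dyadic ρ ^ 2 ^ p = dyadic σ
  supp_eq : supp (dyadic ρ) = supp (dyadic σ)

/-- The standard square root: on words `s ⌢ ε` with `s` in the support of `σ`, it sends `s ⌢ 0` to
`s ⌢ 1` and `s ⌢ 1` to `σ(s) ⌢ 0`; it fixes the other words. -/
def dyadicSqrt {q : ℕ} (σ : Equiv.Perm (Fin q → Bool)) : Equiv.Perm (Fin (q + 1) → Bool) where
  toFun w :=
    if σ (Fin.init w) = Fin.init w then w
    else if w (Fin.last q) then Fin.snoc (α := fun _ => Bool) (σ (Fin.init w)) false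
    else Fin.snoc (α := fun _ => Bool) (Fin.init w) true
  invFun w :=
    if σ (Fin.init w) = Fin.init w then w
    else if w (Fin.last q) then Fin.snoc (α := fun _ => Bool) (Fin.init w) false
    else Fin.snoc (α := fun _ => Bool) (σ.symm (Fin.init w)) true
  left_inv w := by
    induction w using Fin.snocCases with | _ s b => ?_
    by_cases hs : σ s = s <;> cases b <;> simp [hs]
  right_inv w := by
    induction w using Fin.snocCases with | _ s b => ?_
    have h : s = σ.symm s ↔ σ s = s := by rw [Equiv.eq_symm_apply]
    by_cases hs : σ s = s <;> cases b <;> simp [hs, h]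

/-- The standard `2^p`-th root, by iteration of the square root. -/
def dyadicRoot : (p : ℕ) → {q : ℕ} → Equiv.Perm (Fin q → Bool) → Equiv.Perm (Fin (q + p) → Bool)
  | 0, _, σ => σ
  | p + 1, _, σ => dyadicSqrt (dyadicRoot p σ)

theorem dyadicSqrt_dyadicSqrt {q : ℕ} (σ : Equiv.Perm (Fin q → Bool)) (w : Fin (q + 1) → Bool) :
    dyadicSqrt σ (dyadicSqrt σ w) =
      Fin.snoc (α := fun _ => Bool) (σ (Fin.init w)) (w (Fin.last q)) := by
  induction w using Fin.snocCases with | _ s b => ?_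
  by_cases hs : σ s = s <;> cases b <;> simp [dyadicSqrt, hs]

theorem dyadicPerm_prefix {n : ℕ} (σ : Equiv.Perm (Fin n → Bool)) (x : ℕ → Bool) :
    (fun j : Fin n => dyadicPerm σ x j) = σ fun j => x j := by
  funext j
  simp [dyadicPerm_apply]

theorem mem_supp_dyadic {n : ℕ} (σ : Equiv.Perm (Fin n → Bool)) (x : ℕ → Bool) :
    x ∈ supp (dyadic σ) ↔ (σ fun j : Fin n => x j) ≠ fun j : Fin n => x j := by
  refine not_congr ⟨fun h => ?_, fun h => ?_⟩
  · rw [← dyadicPerm_prefix]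
    funext j
    exact congrFun h j
  · funext i
    change dyadicPerm σ x i = x i
    rw [dyadicPerm_apply, h]
    split_ifs <;> rfl

theorem dyadic_dyadicSqrt_sq {q : ℕ} (σ : Equiv.Perm (Fin q → Bool)) :
    dyadic (dyadicSqrt σ) ^ 2 = dyadic σ := by
  rw [pow_two]
  apply Subtype.ext
  apply Equiv.ext
  intro x
  change dyadicPerm (dyadicSqrt σ) (dyadicPerm (dyadicSqrt σ) x) = dyadicPerm σ x
  funext i
  rw [dyadicPerm_apply, dyadicPerm_prefix, dyadicSqrt_dyadicSqrt, dyadicPerm_apply σ]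
  rcases lt_trichotomy i q with h | h | h
  · rw [dif_pos (by omega : i < q + 1), dif_pos h]
    have e : (⟨i, by omega⟩ : Fin (q + 1)) = Fin.castSucc ⟨i, h⟩ := rfl
    rw [e, Fin.snoc_castSucc]
    rfl
  · subst h
    rw [dif_pos (by omega : i < i + 1), dif_neg (lt_irrefl i)]
    have e : (⟨i, by omega⟩ : Fin (i + 1)) = Fin.last i := rfl
    rw [e, Fin.snoc_last]
    rfl
  · rw [dif_neg (by omega), dif_neg (by omega), dyadicPerm_apply, dif_neg (by omega)]

theorem supp_dyadic_dyadicSqrt {q : ℕ} (σ : Equiv.Perm (Fin q → Bool)) :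
    supp (dyadic (dyadicSqrt σ)) = supp (dyadic σ) := by
  ext x
  rw [mem_supp_dyadic, mem_supp_dyadic]
  refine not_congr ?_
  change dyadicSqrt σ (fun j : Fin (q + 1) => x j) = (fun j : Fin (q + 1) => x j) ↔
    σ (Fin.init fun j : Fin (q + 1) => x j) = (Fin.init fun j : Fin (q + 1) => x j)
  generalize (fun j : Fin (q + 1) => x j) = w
  induction w using Fin.snocCases with | _ s b => ?_
  by_cases hs : σ s = s <;> cases b <;> simp [dyadicSqrt, hs, Fin.snoc_inj]

/-- Roots in the sense of `IsDyadicRoot` exist: the standard one is an example. -/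
theorem isDyadicRoot_dyadicRoot (p : ℕ) {q : ℕ} (σ : Equiv.Perm (Fin q → Bool)) :
    IsDyadicRoot p σ (dyadicRoot p σ) := by
  induction p with
  | zero => exact ⟨by rw [pow_zero, pow_one]; rfl, rfl⟩
  | succ p ih =>
    refine ⟨?_, (supp_dyadic_dyadicSqrt _).trans ih.supp_eq⟩
    rw [pow_succ', pow_mul]
    exact (congrArg (· ^ 2 ^ p) (dyadic_dyadicSqrt_sq _)).trans ih.pow_eq

end DyadicFullGroup

open DyadicFullGroup

namespace DyadicFullGroup

/-! Dyadic permutations are dense in the full group (`exists_dist_dyadic_lt`), so it suffices to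
approximate those of level `n k` for large `k`. Reading words of length `n` in binary, least
significant digit first, `T₀` is addition of 1 and `U n` exchanges two consecutive integers.
Conjugating by powers of `T₀` gives every adjacent transposition, hence every permutation of the
words. Since the distance is bi-invariant, replacing `U n` by any `V` costs at most `C n * dist V (U
n)`, where `C n` depends on `n` alone (`exists_uniform_approximation`).

The roots let a single transformation carry all the `U (n k)`. Their supports are disjoint, so the
product acts as one factor at each point (`exists_infinite_product`). In its `2^K`-th power the
factors with `k < K` vanish because `U (n k)` is an involution, and the factor `K` becomes `U (n K)`
restricted to `B K`. The later factors live on sequences constant over their first `n (K+1) - 1`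
digits, a set of tiny measure (`dist_pow_U_le`). Choosing `n (K+1)` and `δ K` in terms of `C (n K)`
makes the total error tend to 0 (`dense_closure_of_dist_pow_le`); starting with `n 0` large makes
the support small. -/

/-! ### Density of the dyadic permutations -/

/-- The first `n` digits of a sequence. -/
def digits (n : ℕ) (x : ℕ → Bool) : Fin n → Bool := fun j => x j

theorem digits_eq_iff {n : ℕ} {x y : ℕ → Bool} : digits n x = digits n y ↔ x ∈ cyl y n := by
  constructor
  · intro h i hi
    exact congrFun h ⟨i, hi⟩
  · intro h
    funext j
    exact h j j.2

/-- The sequence with prescribed first digits and all other digits `0`. -/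
def padWord {n : ℕ} (w : Fin n → Bool) : ℕ → Bool := fun i => if h : i < n then w ⟨i, h⟩ else false

theorem digits_padWord {n : ℕ} (w : Fin n → Bool) : digits n (padWord w) = w := by
  funext j
  simp [digits, padWord]

theorem measurable_digits (n : ℕ) : Measurable (digits n) :=
  measurable_pi_lambda _ fun j => measurable_pi_apply (j : ℕ)

theorem measureReal_digits_preimage {n : ℕ} (W : Finset (Fin n → Bool)) :
    cantorMeasure.real (digits n ⁻¹' (W : Set (Fin n → Bool))) = W.card * 2⁻¹ ^ n := by
  have e : digits n ⁻¹' (W : Set (Fin n → Bool)) = ⋃ w ∈ W, cyl (padWord w) n := by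
    ext x
    simp only [mem_preimage, Finset.mem_coe, mem_iUnion, exists_prop, ← digits_eq_iff,
      digits_padWord]
    simp
  rw [e, measureReal_biUnion_finset]
  · simp [measureReal_def, cantorMeasure_cyl]
  · intro w _ w' _ hne
    refine Set.disjoint_left.2 fun x hx hx' => hne ?_
    rw [← digits_eq_iff, digits_padWord] at hx hx'
    exact hx.symm.trans hx'
  · exact fun w _ => measurableSet_cyl _ _

theorem digits_dyadic {n : ℕ} (σ : Equiv.Perm (Fin n → Bool)) (x : ℕ → Bool) :
    digits n ((dyadic σ : Equiv.Perm (ℕ → Bool)) x) = σ (digits n x) :=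
  dyadicPerm_prefix σ x

theorem dyadic_apply_of_le {n : ℕ} (σ : Equiv.Perm (Fin n → Bool)) (x : ℕ → Bool) {i : ℕ}
    (hi : n ≤ i) : (dyadic σ : Equiv.Perm (ℕ → Bool)) x i = x i := by
  change dyadicPerm σ x i = x i
  rw [dyadicPerm_apply, dif_neg (by omega)]

theorem eq_of_digits_eq {n : ℕ} {x y : ℕ → Bool} (h : digits n x = digits n y)
    (h' : ∀ i, n ≤ i → x i = y i) : x = y := by
  funext i
  rcases lt_or_ge i n with hi | hi
  · exact congrFun h ⟨i, hi⟩
  · exact h' i hi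

/-- A self-map of a finite type agrees with a permutation away from a set whose cardinality is
that of the complement of the range. -/
theorem exists_perm_card_ne_add_card_image {α : Type*} [Fintype α] [DecidableEq α] (h : α → α) :
    ∃ σ : Equiv.Perm α,
      (Finset.univ.filter fun w => σ w ≠ h w).card + (Finset.univ.image h).card
        ≤ Fintype.card α := by
  -- Keep one preimage of each value: `h` is injective on `s`, and the permutation is any extension
  -- of this injection.
  obtain ⟨s, -, hs⟩ := SurjOn.exists_bijOn_subset (surjOn_image h univ)
  classical
  have hcard : (Finset.univ.image h).card = (s.toFinset).card := by
    rw [← Finset.card_image_of_injOn (s := s.toFinset) (f := h) (by simpa using hs.injOn)]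
    congr 1
    ext y
    have := hs.image_eq
    rw [Set.ext_iff] at this
    simpa using (this y).symm
  refine ⟨(hs.equiv h).extendSubtype, ?_⟩
  rw [hcard, ← Finset.card_univ, ← Finset.card_union_of_disjoint]
  · exact Finset.card_le_card (Finset.subset_univ _)
  · refine Finset.disjoint_left.2 fun w hw hw' => ?_
    rw [Finset.mem_filter] at hw
    refine hw.2 ?_
    rw [Equiv.extendSubtype_apply_of_mem _ w (by simpa using hw')]
    rfl

/-- Every measurable set is close to a set which depends on finitely many digits only. -/
theorem exists_measureReal_symmDiff_lt {A : Set (ℕ → Bool)} (hA : MeasurableSet A) {η : ℝ}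
    (hη : 0 < η) : ∃ (M : ℕ) (C : Set (ℕ → Bool)),
      (∀ x y, digits M x = digits M y → x ∈ C → y ∈ C) ∧
        cantorMeasure.real (symmDiff A C) < η := by
  obtain ⟨C, hC, hlt⟩ := (Measure.MeasureDense.of_generateFrom_isSetAlgebra_finite
    (μ := cantorMeasure) isSetAlgebra_measurableCylinders
    generateFrom_measurableCylinders.symm).approx A hA (measure_ne_top _ _) η hη
  rw [mem_measurableCylinders] at hC
  obtain ⟨s, S, -, rfl⟩ := hC
  refine ⟨s.sup id + 1, cylinder s S, fun x y hxy hx => ?_, ?_⟩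
  · rw [mem_cylinder] at hx ⊢
    convert! hx using 1
    funext i
    exact (congrFun hxy ⟨i, Nat.lt_succ_of_le (Finset.le_sup (f := id) i.2)⟩).symm
  · rw [measureReal_def]
    exact (ENNReal.lt_ofReal_iff_toReal_lt (measure_ne_top _ _)).1 hlt

/-- If the first `n` digits of `T x` depend only on those of `x` off a set `E`, and if `T` does not
change the other digits off `E`, then `T` is at distance at most `2 μ(E)` from a dyadic
permutation. -/
theorem exists_dist_dyadic_le (T : PreFullGroup cantorMeasure R₀) {n : ℕ}
    (h : (Fin n → Bool) → Fin n → Bool) (E : Set (ℕ → Bool))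
    (hE : ∀ x ∉ E, digits n ((T : Equiv.Perm (ℕ → Bool)) x) = h (digits n x))
    (hE' : ∀ x ∉ E, ∀ i, n ≤ i → (T : Equiv.Perm (ℕ → Bool)) x i = x i) :
    ∃ σ : Equiv.Perm (Fin n → Bool), dist T (dyadic σ) ≤ 2 * cantorMeasure.real E := by
  obtain ⟨σ, hσ⟩ := exists_perm_card_ne_add_card_image h
  refine ⟨σ, ?_⟩
  -- Off `E`, `T` lands in the words of the range of `h`. As `T` preserves measure, that range
  -- misses words of total measure at most `μ(E)`, which bounds the words where `σ` and `h` differ.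
  -- This is the second `μ(E)` in the bound.
  have h1 : 1 - cantorMeasure.real E ≤ (Finset.univ.image h).card * 2⁻¹ ^ n := by
    rw [← measureReal_digits_preimage]
    have hm : MeasurableSet (digits n ⁻¹' ((Finset.univ.image h : Finset _) : Set (Fin n → Bool))) :=
      measurable_digits n (Set.toFinite _).measurableSet
    have h2 : Eᶜ ⊆ (T : Equiv.Perm (ℕ → Bool)) ⁻¹'
        (digits n ⁻¹' ((Finset.univ.image h : Finset _) : Set (Fin n → Bool))) := by
      intro x hx
      simp only [mem_preimage, hE x hx]
      simp
    have h3 := measureReal_mono h2 (μ := cantorMeasure)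
    rw [measureReal_def (s := _ ⁻¹' _), T.2.1.measure_preimage hm.nullMeasurableSet,
      ← measureReal_def] at h3
    have h4 := measureReal_union_le (μ := cantorMeasure) E Eᶜ
    rw [union_compl_self, probReal_univ] at h4
    linarith
  have hsub : {x | (T : Equiv.Perm (ℕ → Bool)) x ≠ (dyadic σ : Equiv.Perm (ℕ → Bool)) x} ⊆
      E ∪ digits n ⁻¹' ((Finset.univ.filter fun w => σ w ≠ h w : Finset _) :
        Set (Fin n → Bool)) := by
    intro x hx
    by_contra hx'
    simp only [mem_union, not_or, mem_preimage, Finset.coe_filter, Finset.mem_univ, true_and,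
      mem_ofPred_eq, not_not] at hx'
    refine hx (eq_of_digits_eq (n := n) ?_ fun i hi => ?_)
    · rw [hE x hx'.1, digits_dyadic, hx'.2]
    · rw [hE' x hx'.1 i hi, dyadic_apply_of_le σ x hi]
  rw [dist_def]
  refine (measureReal_mono hsub).trans ((measureReal_union_le _ _).trans ?_)
  rw [measureReal_digits_preimage]
  have hσ' : ((Finset.univ.filter fun w => σ w ≠ h w).card : ℝ) + (Finset.univ.image h).card
      ≤ 2 ^ n := by
    have := hσ
    simp only [Fintype.card_pi, Fintype.card_bool, Finset.prod_const, Finset.card_univ,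
      Fintype.card_fin] at this
    exact_mod_cast this
  have hp : (2 : ℝ) ^ n * 2⁻¹ ^ n = 1 := by rw [← mul_pow]; norm_num
  have := mul_le_mul_of_nonneg_right hσ' (by positivity : (0 : ℝ) ≤ 2⁻¹ ^ n)
  rw [hp, add_mul] at this
  linarith

/-- These sets decrease with `N`, and their intersection is null because `T x` is `R₀`-equivalent to
`x` almost everywhere. -/
theorem exists_measureReal_tail_ne_lt (T : PreFullGroup cantorMeasure R₀) {η : ℝ} (hη : 0 < η) :
    ∃ N, cantorMeasure.real {x | ¬ ∀ i, N ≤ i → (T : Equiv.Perm (ℕ → Bool)) x i = x i} < η := by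
  set s : ℕ → Set (ℕ → Bool) :=
    fun N => {x | ¬ ∀ i, N ≤ i → (T : Equiv.Perm (ℕ → Bool)) x i = x i} with hs
  have hm : ∀ N, MeasurableSet (s N) := fun N => by
    have e : s N = (⋂ i, ⋂ (_ : N ≤ i), {x | (T : Equiv.Perm (ℕ → Bool)) x i = x i})ᶜ := by
      ext x
      simp [hs]
    rw [e]
    refine (MeasurableSet.iInter fun i => MeasurableSet.iInter fun _ =>
      measurableSet_eq_fun ?_ (measurable_pi_apply i)).compl
    exact (measurable_pi_apply i).comp T.2.1.measurable
  have ha : Antitone s := fun N M hNM x hx h => hx fun i hi => h i (hNM.trans hi)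
  have h0 : cantorMeasure (⋂ N, s N) = 0 := by
    refine measure_mono_null ?_ (ae_iff.1 T.2.2.2)
    rintro x hx ⟨N, hN⟩
    exact mem_iInter.1 hx N hN
  have ht := tendsto_measure_iInter_atTop (μ := cantorMeasure)
    (fun N => (hm N).nullMeasurableSet) ha ⟨0, measure_ne_top _ _⟩
  rw [h0] at ht
  obtain ⟨N, hN⟩ := (ht.eventually_lt_const (ENNReal.ofReal_pos.2 hη)).exists
  exact ⟨N, (ENNReal.lt_ofReal_iff_toReal_lt (measure_ne_top _ _)).1 hN⟩

/-- Up to measure `η / 4` only the first `N` digits change, and up to another `η / 4` each of these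
output digits is a function of finitely many input digits. Every level `M ≥ M₀` is allowed, so that
`M` can later be some `n k`. -/
theorem exists_dist_dyadic_lt (T : PreFullGroup cantorMeasure R₀) {η : ℝ} (hη : 0 < η) :
    ∃ M₀, ∀ M, M₀ ≤ M → ∃ σ : Equiv.Perm (Fin M → Bool), dist T (dyadic σ) < η := by
  obtain ⟨N, hN⟩ := exists_measureReal_tail_ne_lt T (by positivity : 0 < η / 4)
  have hA : ∀ i, MeasurableSet {x | (T : Equiv.Perm (ℕ → Bool)) x i = true} := fun i =>
    measurableSet_eq_fun ((measurable_pi_apply i).comp T.2.1.measurable) measurable_const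
  choose M C hC hlt using fun i =>
    exists_measureReal_symmDiff_lt (hA i) (by positivity : 0 < η / (4 * (N + 1)))
  refine ⟨max N ((Finset.range N).sup M), fun m hm => ?_⟩
  have hNm : N ≤ m := (le_max_left _ _).trans hm
  have hMm : ∀ i < N, M i ≤ m := fun i hi =>
    ((Finset.le_sup (f := M) (Finset.mem_range.2 hi)).trans (le_max_right _ _)).trans hm
  have hC' : ∀ i < N, ∀ x, padWord (digits m x) ∈ C i ↔ x ∈ C i := by
    intro i hi x
    have e : digits (M i) (padWord (digits m x)) = digits (M i) x := by
      funext j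
      have : (j : ℕ) < m := j.2.trans_le (hMm i hi)
      simp [digits, padWord, this]
    exact ⟨hC i _ _ e, hC i _ _ e.symm⟩
  set E : Set (ℕ → Bool) := {x | ¬ ∀ i, N ≤ i → (T : Equiv.Perm (ℕ → Bool)) x i = x i} ∪
    ⋃ i ∈ Finset.range N, symmDiff {x | (T : Equiv.Perm (ℕ → Bool)) x i = true} (C i) with hEdef
  have hEm : cantorMeasure.real E < η / 2 := by
    have h1 := measureReal_union_le (μ := cantorMeasure)
      {x | ¬ ∀ i, N ≤ i → (T : Equiv.Perm (ℕ → Bool)) x i = x i}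
      (⋃ i ∈ Finset.range N, symmDiff {x | (T : Equiv.Perm (ℕ → Bool)) x i = true} (C i))
    have h2 := measureReal_biUnion_finset_le (μ := cantorMeasure) (Finset.range N)
      (fun i => symmDiff {x | (T : Equiv.Perm (ℕ → Bool)) x i = true} (C i))
    have h3 := Finset.sum_le_card_nsmul (Finset.range N)
      (fun i => cantorMeasure.real (symmDiff {x | (T : Equiv.Perm (ℕ → Bool)) x i = true} (C i)))
      (η / (4 * (N + 1))) fun i _ => (hlt i).le
    rw [Finset.card_range, nsmul_eq_mul] at h3
    have h4 : (N : ℝ) * (η / (4 * (N + 1))) ≤ η / 4 := by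
      rw [mul_div_assoc', div_le_div_iff₀ (by positivity) (by positivity)]
      nlinarith
    linarith
  classical
  suffices h : ∃ σ : Equiv.Perm (Fin m → Bool),
      dist T (dyadic σ) ≤ 2 * cantorMeasure.real E from
    h.imp fun σ hσ => hσ.trans_lt (by linarith)
  refine exists_dist_dyadic_le T
    (fun w j => if (j : ℕ) < N then decide (padWord w ∈ C j) else w j) E ?_ ?_
  · intro x hx
    simp only [hEdef, mem_union, not_or, mem_ofPred_eq, not_not, mem_iUnion, not_exists,
      Finset.mem_range] at hx
    funext j
    by_cases hj : (j : ℕ) < N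
    · have := hx.2 j hj
      rw [mem_symmDiff] at this
      simp only [hj, if_true, hC' j hj]
      change (T : Equiv.Perm (ℕ → Bool)) x j = _
      simp only [mem_ofPred_eq] at this
      by_cases hxC : x ∈ C j
      · simp only [hxC, decide_true]
        tauto
      · simp only [hxC, decide_false]
        rw [← Bool.not_eq_true]
        tauto
    · simp only [hj, if_false]
      exact hx.1 j (by omega)
  · intro x hx i hi
    simp only [hEdef, mem_union, not_or, mem_ofPred_eq, not_not] at hx
    exact hx.1 i (hNm.trans hi)

/-! ### The odometer and one transposition generate the dyadic permutations -/

theorem dyadic_mul {n : ℕ} (σ σ' : Equiv.Perm (Fin n → Bool)) :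
    dyadic (σ * σ') = dyadic σ * dyadic σ' := by
  refine Subtype.ext (Equiv.ext fun x => eq_of_digits_eq (n := n) ?_ fun i hi => ?_)
  · change _ = digits n ((dyadic σ : Equiv.Perm (ℕ → Bool)) ((dyadic σ' : Equiv.Perm (ℕ → Bool)) x))
    rw [digits_dyadic, digits_dyadic, digits_dyadic, Equiv.Perm.mul_apply]
  · change _ = (dyadic σ : Equiv.Perm (ℕ → Bool)) ((dyadic σ' : Equiv.Perm (ℕ → Bool)) x) i
    rw [dyadic_apply_of_le _ _ hi, dyadic_apply_of_le _ _ hi, dyadic_apply_of_le _ _ hi]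

theorem dyadic_one (n : ℕ) : dyadic (1 : Equiv.Perm (Fin n → Bool)) = 1 := by
  have h := dyadic_mul (1 : Equiv.Perm (Fin n → Bool)) 1
  rw [one_mul] at h
  exact left_eq_mul.1 h

/-- Addition of `1` modulo `2^n` on words of length `n`. -/
def wordSucc {n : ℕ} (w : Fin n → Bool) : Fin n → Bool :=
  fun j => if ∀ l < j, w l = true then !w j else w j

theorem digits_odometer (n : ℕ) (x : ℕ → Bool) :
    digits n (odometerPerm x) = wordSucc (digits n x) := by
  funext j
  have e : (∀ l < (j : ℕ), x l = true) ↔ ∀ l < j, digits n x l = true :=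
    ⟨fun h l hl => h l hl, fun h l hl => h ⟨l, hl.trans j.2⟩ hl⟩
  exact if_congr e rfl rfl

theorem odometer_apply_of_le {n : ℕ} {x : ℕ → Bool} (hx : digits n x ≠ fun _ => true) {i : ℕ}
    (hi : n ≤ i) : odometerPerm x i = x i := by
  rw [odometerPerm_apply, if_neg]
  exact fun h => hx (funext fun j => h j (j.2.trans_le hi))

theorem wordSucc_injective (n : ℕ) : Function.Injective (wordSucc (n := n)) := by
  intro w w' h
  suffices h' : ∀ k, ∀ j : Fin n, (j : ℕ) = k → w j = w' j from funext fun j => h' j j rfl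
  intro k
  induction k using Nat.strong_induction_on with
  | _ k ih =>
    rintro j rfl
    have hj := congrFun h j
    have e : (∀ l < j, w l = true) ↔ ∀ l < j, w' l = true :=
      forall₂_congr fun l hl => by rw [ih l hl l rfl]
    simp only [wordSucc, e] at hj
    split_ifs at hj
    · exact Bool.not_inj hj
    · exact hj

/-- The odometer carries beyond the first `n` digits only at the all-ones word, which the
transposition fixes; hence the conjugation identity is exact. -/
theorem odometer_mul_dyadic_swap {n : ℕ} {a b : Fin n → Bool} (ha : a ≠ fun _ => true)
    (hb : b ≠ fun _ => true) :
    T₀ * dyadic (Equiv.swap a b) = dyadic (Equiv.swap (wordSucc a) (wordSucc b)) * T₀ := by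
  refine Subtype.ext (Equiv.ext fun x => eq_of_digits_eq (n := n) ?_ fun i hi => ?_)
  · change digits n (odometerPerm ((dyadic (Equiv.swap a b) : Equiv.Perm (ℕ → Bool)) x)) =
      digits n ((dyadic (Equiv.swap (wordSucc a) (wordSucc b)) : Equiv.Perm (ℕ → Bool))
        (odometerPerm x))
    rw [digits_odometer, digits_dyadic, digits_dyadic, digits_odometer]
    exact (wordSucc_injective n).map_swap _ _ _
  · change odometerPerm ((dyadic (Equiv.swap a b) : Equiv.Perm (ℕ → Bool)) x) i =
      (dyadic (Equiv.swap (wordSucc a) (wordSucc b)) : Equiv.Perm (ℕ → Bool)) (odometerPerm x) i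
    rw [dyadic_apply_of_le _ _ hi]
    by_cases hx : digits n x = fun _ => true
    · have : (dyadic (Equiv.swap a b) : Equiv.Perm (ℕ → Bool)) x = x := by
        refine eq_of_digits_eq (n := n) ?_ fun i hi => dyadic_apply_of_le _ _ hi
        rw [digits_dyadic, hx, Equiv.swap_apply_of_ne_of_ne ha.symm hb.symm]
      rw [this]
    · rw [odometer_apply_of_le hx hi, odometer_apply_of_le _ hi, dyadic_apply_of_le _ _ hi]
      rw [digits_dyadic, Equiv.swap_apply_def]
      split_ifs <;> assumption

/-- The word of length `n` given by the binary digits of `i`, the least significant one first. -/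
def binWord (n i : ℕ) : Fin n → Bool := fun j => i.testBit j

theorem testBit_add_one (i j : ℕ) :
    (i + 1).testBit j = if ∀ l < j, i.testBit l = true then !i.testBit j else i.testBit j := by
  induction j generalizing i with
  | zero =>
    simp only [not_lt_zero, false_imp_iff, implies_true, if_true, Nat.testBit_zero]
    rcases Nat.mod_two_eq_zero_or_one i with h | h <;> simp [Nat.add_mod, h]
  | succ j ih =>
    rw [Nat.testBit_succ, Nat.testBit_succ]
    have e : (∀ l < j + 1, i.testBit l = true) ↔
        i % 2 = 1 ∧ ∀ l < j, (i / 2).testBit l = true := by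
      constructor
      · intro h
        refine ⟨by simpa [Nat.testBit_zero] using h 0 (by omega), fun l hl => ?_⟩
        rw [← Nat.testBit_succ]
        exact h _ (by omega)
      · rintro ⟨h0, h⟩ l hl
        cases l with
        | zero => simpa [Nat.testBit_zero] using h0
        | succ l =>
          rw [Nat.testBit_succ]
          exact h l (by omega)
    simp only [e]
    rcases Nat.mod_two_eq_zero_or_one i with h | h
    · have : (i + 1) / 2 = i / 2 := by omega
      simp [this, h]
    · have : (i + 1) / 2 = i / 2 + 1 := by omega
      simp [this, h, ih]

theorem wordSucc_binWord (n i : ℕ) : wordSucc (binWord n i) = binWord n (i + 1) := by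
  funext j
  have e : (∀ l < j, binWord n i l = true) ↔ ∀ l < (j : ℕ), i.testBit l = true :=
    ⟨fun h l hl => h ⟨l, hl.trans j.2⟩ hl, fun h l hl => h l hl⟩
  simp only [wordSucc, e]
  exact (testBit_add_one i j).symm

theorem binWord_ne_true {n i : ℕ} (hi : i + 1 < 2 ^ n) : binWord n i ≠ fun _ => true := by
  intro h
  have : i = 2 ^ n - 1 := by
    refine Nat.eq_of_testBit_eq fun j => ?_
    rw [Nat.testBit_two_pow_sub_one]
    by_cases hj : j < n
    · simpa [hj, binWord] using congrFun h ⟨j, hj⟩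
    · rw [Nat.testBit_lt_two_pow]
      · simp [hj]
      · exact (by omega : i < 2 ^ n).trans_le (Nat.pow_le_pow_right (by norm_num) (by omega))
  omega

theorem exists_binWord {n : ℕ} (w : Fin n → Bool) : ∃ i < 2 ^ n, binWord n i = w :=
  ⟨Nat.ofBits w, Nat.ofBits_lt_two_pow w, funext fun j => by simp [binWord]⟩

/-- `1^{n-1} 0` and `0^{n-1} 1` encode the consecutive integers `2^(n-1) - 1` and `2^(n-1)`. -/
theorem τ_eq_swap {n : ℕ} (hn : 1 ≤ n) :
    τ n = Equiv.swap (binWord n (2 ^ (n - 1) - 1)) (binWord n (2 ^ (n - 1) - 1 + 1)) := by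
  rw [τ, Equiv.swap_comm]
  congr 1
  · funext j
    rw [binWord, Nat.testBit_two_pow_sub_one]
    have := j.2
    simp only [decide_eq_decide]
    omega
  · funext j
    rw [binWord, Nat.sub_add_cancel Nat.one_le_two_pow, Nat.testBit_two_pow]
    have := j.2
    simp only [decide_eq_decide]
    omega

/-- `σ` is approximated by words in `T₀` and `V` with an error controlled linearly by the distance
of `V` to `U n`. -/
def Approximable {n : ℕ} (σ : Equiv.Perm (Fin n → Bool)) : Prop :=
  ∃ C : ℝ, 0 ≤ C ∧ ∀ V : PreFullGroup cantorMeasure R₀,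
    ∃ g ∈ Subgroup.closure {T₀, V}, dist g (dyadic σ) ≤ C * dist V (U n)

theorem Approximable.one (n : ℕ) : Approximable (1 : Equiv.Perm (Fin n → Bool)) :=
  ⟨0, le_rfl, fun V => ⟨1, one_mem _, by simp [dyadic_one]⟩⟩

theorem approximable_τ (n : ℕ) : Approximable (τ n) :=
  ⟨1, zero_le_one, fun V => ⟨V, Subgroup.subset_closure (by simp), by rw [one_mul]; rfl⟩⟩

/-- By bi-invariance of the distance, the errors of the factors add up. -/
theorem Approximable.mul {n : ℕ} {σ σ' : Equiv.Perm (Fin n → Bool)} (h : Approximable σ)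
    (h' : Approximable σ') : Approximable (σ * σ') := by
  obtain ⟨C, hC, h⟩ := h
  obtain ⟨C', hC', h'⟩ := h'
  refine ⟨C + C', add_nonneg hC hC', fun V => ?_⟩
  obtain ⟨g, hg, hgd⟩ := h V
  obtain ⟨g', hg', hgd'⟩ := h' V
  refine ⟨g * g', mul_mem hg hg', ?_⟩
  rw [dyadic_mul, add_mul]
  refine (dist_triangle _ (dyadic σ * g') _).trans ?_
  rw [dist_mul_right, dist_mul_left]
  exact add_le_add hgd hgd'

theorem approximable_of_conj {n : ℕ} {σ σ' : Equiv.Perm (Fin n → Bool)}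
    {t : PreFullGroup cantorMeasure R₀} (ht : t ∈ Subgroup.closure {T₀})
    (h : t * dyadic σ = dyadic σ' * t) (hσ : Approximable σ) : Approximable σ' := by
  obtain ⟨C, hC, hσ⟩ := hσ
  refine ⟨C, hC, fun V => ?_⟩
  obtain ⟨g, hg, hgd⟩ := hσ V
  have ht' : t ∈ Subgroup.closure {T₀, V} :=
    Subgroup.closure_mono (by simp) ht
  refine ⟨t * g * t⁻¹, mul_mem (mul_mem ht' hg) (inv_mem ht'), ?_⟩
  rw [← dist_mul_right t, inv_mul_cancel_right, ← h, dist_mul_left]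
  exact hgd

theorem approximable_swap_wordSucc_iff {n : ℕ} {a b : Fin n → Bool} (ha : a ≠ fun _ => true)
    (hb : b ≠ fun _ => true) :
    Approximable (Equiv.swap (wordSucc a) (wordSucc b)) ↔ Approximable (Equiv.swap a b) := by
  have h := odometer_mul_dyadic_swap ha hb
  have hT : T₀ ∈ Subgroup.closure {T₀} := Subgroup.subset_closure rfl
  refine ⟨approximable_of_conj (inv_mem hT) ?_, approximable_of_conj hT h⟩
  rw [inv_mul_eq_iff_eq_mul, ← mul_assoc, h, mul_inv_cancel_right]

theorem approximable_swap_succ {n : ℕ} (hn : 1 ≤ n) {i : ℕ} (hi : i + 1 < 2 ^ n) :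
    Approximable (Equiv.swap (binWord n i) (binWord n (i + 1))) := by
  have step : ∀ i, i + 1 + 1 < 2 ^ n →
      (Approximable (Equiv.swap (binWord n (i + 1)) (binWord n (i + 1 + 1))) ↔
        Approximable (Equiv.swap (binWord n i) (binWord n (i + 1)))) := by
    intro i hi
    have h := approximable_swap_wordSucc_iff (binWord_ne_true (i := i) (Nat.lt_of_succ_lt hi))
      (binWord_ne_true hi)
    rwa [wordSucc_binWord n i, wordSucc_binWord n (i + 1)] at h
  -- Conjugation by `T₀` is reversible: descend from the known transposition at `2^(n-1) - 1` to the
  -- one at 0, then climb to any `i`, never wrapping around.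
  have zero_iff : ∀ i, i + 1 < 2 ^ n →
      (Approximable (Equiv.swap (binWord n i) (binWord n (i + 1))) ↔
        Approximable (Equiv.swap (binWord n 0) (binWord n (0 + 1)))) := by
    intro i hi
    induction i with
    | zero => rfl
    | succ i ih => rw [step i hi, ih (by omega)]
  rw [zero_iff i hi, ← zero_iff (2 ^ (n - 1) - 1), ← τ_eq_swap hn]
  · exact approximable_τ n
  · obtain ⟨m, rfl⟩ := Nat.exists_eq_add_of_le' hn
    have := Nat.one_le_two_pow (n := m)
    rw [Nat.add_sub_cancel, pow_succ]
    omega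

theorem approximable_swap_trans {n : ℕ} {a b c : Fin n → Bool}
    (hab : Approximable (Equiv.swap a b)) (hbc : Approximable (Equiv.swap b c)) :
    Approximable (Equiv.swap a c) := by
  by_cases h : b = a
  · rwa [← h]
  by_cases h' : b = c
  · rwa [← h']
  by_cases h'' : a = c
  · rw [h'', Equiv.swap_self]
    exact Approximable.one n
  · rw [Equiv.swap_comm, ← Equiv.swap_mul_swap_mul_swap (Ne.symm h) h'']
    exact (hbc.mul hab).mul hbc

theorem approximable {n : ℕ} (hn : 1 ≤ n) (σ : Equiv.Perm (Fin n → Bool)) : Approximable σ := by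
  have h0 : ∀ i < 2 ^ n, Approximable (Equiv.swap (binWord n 0) (binWord n i)) := by
    intro i hi
    induction i with
    | zero =>
      rw [Equiv.swap_self]
      exact Approximable.one n
    | succ i ih => exact approximable_swap_trans (ih (by omega)) (approximable_swap_succ hn hi)
  induction σ using Equiv.Perm.swap_induction_on with
  | one => exact Approximable.one n
  | swap_mul f x y _ hf =>
    refine Approximable.mul ?_ hf
    obtain ⟨i, hi, rfl⟩ := exists_binWord x
    obtain ⟨j, hj, rfl⟩ := exists_binWord y
    refine approximable_swap_trans (b := binWord n 0) ?_ (h0 j hj)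
    rw [Equiv.swap_comm]
    exact h0 i hi

theorem exists_uniform_approximation {n : ℕ} (hn : 1 ≤ n) :
    ∃ C : ℝ, 0 ≤ C ∧ ∀ (V : PreFullGroup cantorMeasure R₀) (σ : Equiv.Perm (Fin n → Bool)),
      ∃ g ∈ Subgroup.closure {T₀, V}, dist g (dyadic σ) ≤ C * dist V (U n) := by
  choose C hC h using fun σ : Equiv.Perm (Fin n → Bool) => approximable hn σ
  -- There are finitely many `σ`, so the sum of their constants serves for all of them.
  refine ⟨∑ σ, C σ, Finset.sum_nonneg fun σ _ => hC σ, fun V σ => ?_⟩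
  obtain ⟨g, hg, hd⟩ := h σ V
  refine ⟨g, hg, hd.trans (mul_le_mul_of_nonneg_right ?_ dist_nonneg)⟩
  exact Finset.single_le_sum (f := C) (fun σ _ => hC σ) (Finset.mem_univ σ)

/-! ### Supports of the transpositions -/

/-- The sequences whose first `m` digits are all equal. -/
def constInitial (m : ℕ) : Set (ℕ → Bool) := {x | ∀ i < m, x i = x 0}

theorem constInitial_antitone : Antitone constInitial :=
  fun _ _ h _ hx i hi => hx i (hi.trans_le h)

theorem measureReal_constInitial_le (m : ℕ) :
    cantorMeasure.real (constInitial m) ≤ 2 * 2⁻¹ ^ m := by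
  have h : constInitial m ⊆ cyl (fun _ => false) m ∪ cyl (fun _ => true) m := by
    intro x hx
    cases h0 : x 0
    · exact Or.inl fun i hi => (hx i hi).trans h0
    · exact Or.inr fun i hi => (hx i hi).trans h0
  refine (measureReal_mono h).trans ((measureReal_union_le _ _).trans (le_of_eq ?_))
  simp only [measureReal_def, cantorMeasure_cyl, ENNReal.toReal_pow, ENNReal.toReal_inv,
    ENNReal.toReal_ofNat]
  ring

/-- Treats both exchanged words at once: `b` is the repeated digit, flipped at the last position. -/
theorem exists_of_mem_supp_U {n : ℕ} {x : ℕ → Bool} (hx : x ∈ supp (U n)) :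
    ∃ b : Bool, ∀ i < n, x i = (b ^^ decide (i + 1 = n)) := by
  rw [U, mem_supp_dyadic] at hx
  by_contra! h
  refine hx (Equiv.swap_apply_of_ne_of_ne ?_ ?_)
  · intro h'
    obtain ⟨i, hi, hne⟩ := h false
    have := congrFun h' ⟨i, hi⟩
    exact hne (by simpa using this)
  · intro h'
    obtain ⟨i, hi, hne⟩ := h true
    have := congrFun h' ⟨i, hi⟩
    exact hne (by simpa using this)

theorem supp_U_subset (n : ℕ) : supp (U n) ⊆ constInitial (n - 1) := by
  intro x hx i hi
  obtain ⟨b, hb⟩ := exists_of_mem_supp_U hx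
  rw [hb i (by omega), hb 0 (by omega)]
  congr 1
  simp only [decide_eq_decide]
  omega

/-- Digits 0 and `n - 1` differ on the first support and agree on the second; `2 ≤ n` makes these
positions distinct. -/
theorem disjoint_supp_U {n m : ℕ} (hn : 2 ≤ n) (hnm : n < m) :
    Disjoint (supp (U n)) (supp (U m)) := by
  refine Set.disjoint_left.2 fun x hx hx' => ?_
  obtain ⟨b, hb⟩ := exists_of_mem_supp_U hx
  have h := supp_U_subset m hx' (n - 1) (by omega)
  rw [hb _ (by omega), hb 0 (by omega), decide_eq_true (by omega : n - 1 + 1 = n),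
    decide_eq_false (by omega : ¬ 0 + 1 = n)] at h
  cases b <;> simp at h

theorem U_mul_self (n : ℕ) : U n * U n = 1 := by
  rw [U, ← dyadic_mul, τ, Equiv.swap_mul_self, dyadic_one]

/-! ### Infinite products of transformations with disjoint supports -/

section General

variable {X : Type*}

theorem pow_apply_of_eqOn {f g : Equiv.Perm X} {A : Set X} (h : ∀ x ∈ A, f x = g x)
    (hg : ∀ x ∈ A, g x ∈ A) (j : ℕ) : ∀ x ∈ A, (f ^ j) x = (g ^ j) x := by
  induction j with
  | zero => exact fun x _ => rfl
  | succ j ih =>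
    intro x hx
    rw [pow_succ, pow_succ, Equiv.Perm.mul_apply, Equiv.Perm.mul_apply, h x hx, ih _ (hg x hx)]

theorem exists_glued_perm (e : ℕ → Equiv.Perm X) (D : ℕ → Set X)
    (hD : ∀ k l, k ≠ l → Disjoint (D k) (D l)) (he : ∀ k x, e k x ∈ D k ↔ x ∈ D k) :
    ∃ g : Equiv.Perm X, (∀ k, ∀ x ∈ D k, g x = e k x) ∧ ∀ x, (∀ k, x ∉ D k) → g x = x := by
  have glue : ∀ e : ℕ → Equiv.Perm X, ∃ f : X → X,
      (∀ k, ∀ x ∈ D k, f x = e k x) ∧ ∀ x, (∀ k, x ∉ D k) → f x = x := by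
    classical
    intro e
    refine ⟨fun x => if h : ∃ k, x ∈ D k then e h.choose x else x, fun k x hx => ?_,
      fun x hx => dif_neg fun ⟨k, hk⟩ => hx k hk⟩
    have h : ∃ k, x ∈ D k := ⟨k, hx⟩
    have hk : h.choose = k := by
      by_contra hne
      exact Set.disjoint_left.1 (hD _ _ hne) h.choose_spec hx
    simp only [dif_pos h, hk]
  obtain ⟨f, hf, hf'⟩ := glue e
  obtain ⟨g, hg, hg'⟩ := glue fun k => (e k).symm
  have he' : ∀ k x, x ∈ D k → (e k).symm x ∈ D k := fun k x hx => by
    rwa [← he, Equiv.apply_symm_apply]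
  refine ⟨⟨f, g, fun x => ?_, fun x => ?_⟩, hf, hf'⟩
  · by_cases h : ∃ k, x ∈ D k
    · obtain ⟨k, hk⟩ := h
      rw [hf k x hk, hg k _ ((he k x).2 hk), Equiv.symm_apply_apply]
    · rw [not_exists] at h
      rw [hf' x h, hg' x h]
  · by_cases h : ∃ k, x ∈ D k
    · obtain ⟨k, hk⟩ := h
      rw [hg k x hk, hf k _ (he' k x hk), Equiv.apply_symm_apply]
    · rw [not_exists] at h
      rw [hg' x h, hf' x h]

variable [MeasurableSpace X] {μ : Measure X} {R : Setoid X}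

/-- Indicators of preimages converge pointwise, so on a finite measure space the measures of the
preimages converge too. -/
theorem measurePreserving_of_eventually_eq [IsFiniteMeasure μ] {f : ℕ → X → X} {g : X → X}
    (hf : ∀ N, MeasurePreserving (f N) μ μ) (h : ∀ x, ∀ᶠ N in atTop, f N x = g x) :
    MeasurePreserving g μ μ := by
  have hlim : ∀ s : Set X, ∀ x, ∀ᶠ N in atTop, x ∈ f N ⁻¹' s ↔ x ∈ g ⁻¹' s := fun s x => by
    filter_upwards [h x] with N hN
    rw [mem_preimage, mem_preimage, hN]
  have hm : Measurable g := fun s hs =>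
    measurableSet_of_tendsto_indicator atTop (fun N => (hf N).measurable hs)
      (hlim s)
  refine ⟨hm, Measure.ext fun s hs => ?_⟩
  rw [Measure.map_apply hm hs]
  have ht := tendsto_measure_of_tendsto_indicator_of_isFiniteMeasure (μ := μ) atTop
    (fun N => (hf N).measurable hs) (hlim s)
  simp only [fun N => (hf N).measure_preimage hs.nullMeasurableSet] at ht
  exact tendsto_nhds_unique ht tendsto_const_nhds

theorem mem_preFullGroup_of_eventually_eq [IsFiniteMeasure μ] (S : ℕ → PreFullGroup μ R)
    (V : Equiv.Perm X) (h : ∀ x, ∀ᶠ N in atTop, (S N : Equiv.Perm X) x = V x) :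
    V ∈ PreFullGroup μ R := by
  refine ⟨measurePreserving_of_eventually_eq (fun N => (S N).2.1) h,
    measurePreserving_of_eventually_eq (fun N => (S N).2.2.1) fun x => ?_, ?_⟩
  · filter_upwards [h (V.symm x)] with N hN
    rw [Equiv.symm_apply_eq, hN, Equiv.apply_symm_apply]
  · filter_upwards [ae_all_iff.2 fun N => (S N).2.2.2] with x hx
    obtain ⟨N, hN⟩ := (h x).exists
    rw [← hN]
    exact hx N

/-- Each point lies in at most one `D k`, so the partial products are eventually constant at every
point. The last clause turns this into convergence for the uniform distance. -/
theorem exists_infinite_product [IsFiniteMeasure μ] (e : ℕ → PreFullGroup μ R) (D : ℕ → Set X)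
    (hD : ∀ k l, k ≠ l → Disjoint (D k) (D l))
    (he : ∀ k x, (e k : Equiv.Perm X) x ∈ D k ↔ x ∈ D k)
    (he' : ∀ k, ∀ x ∉ D k, (e k : Equiv.Perm X) x = x) :
    ∃ V : PreFullGroup μ R, (∀ k, ∀ x ∈ D k, (V : Equiv.Perm X) x = (e k : Equiv.Perm X) x) ∧
      (∀ x, (∀ k, x ∉ D k) → (V : Equiv.Perm X) x = x) ∧
      ∀ N, {x | (((List.range N).map e).prod : Equiv.Perm X) x ≠ (V : Equiv.Perm X) x} ⊆
        ⋃ k, ⋃ (_ : N ≤ k), D k := by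
  have hprod : ∀ N x, (∀ k < N, x ∈ D k →
      (((List.range N).map e).prod : Equiv.Perm X) x = (e k : Equiv.Perm X) x) ∧
      ((∀ k < N, x ∉ D k) → (((List.range N).map e).prod : Equiv.Perm X) x = x) := by
    intro N
    induction N with
    | zero => exact fun x => ⟨fun k hk => absurd hk (by omega), fun _ => rfl⟩
    | succ N ih =>
      have hs : ∀ x, (((List.range (N + 1)).map e).prod : Equiv.Perm X) x =
          (((List.range N).map e).prod : Equiv.Perm X) ((e N : Equiv.Perm X) x) := fun x => by
        rw [List.range_succ, List.map_append, List.prod_append]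
        simp
      refine fun x => ⟨fun k hk hx => ?_, fun hx => ?_⟩
      · rw [hs]
        rcases Nat.lt_succ_iff_lt_or_eq.1 hk with hk | rfl
        · rw [he' N x (Set.disjoint_left.1 (hD k N hk.ne) hx)]
          exact (ih x).1 k hk hx
        · refine (ih _).2 fun l hl => ?_
          exact Set.disjoint_left.1 (hD k l hl.ne') ((he k x).2 hx)
      · rw [hs, he' N x (hx N (by omega))]
        exact (ih x).2 fun k hk => hx k (by omega)
  obtain ⟨V, hV, hV'⟩ := exists_glued_perm (fun k => (e k : Equiv.Perm X)) D hD he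
  have heq : ∀ N x, (∀ k, N ≤ k → x ∉ D k) →
      (((List.range N).map e).prod : Equiv.Perm X) x = V x := by
    intro N x hx
    by_cases h : ∃ k, x ∈ D k
    · obtain ⟨k, hk⟩ := h
      rw [hV k x hk]
      exact (hprod N x).1 k (lt_of_not_ge fun h => hx k h hk) hk
    · rw [not_exists] at h
      rw [hV' x h]
      exact (hprod N x).2 fun k _ => h k
  have hev : ∀ x, ∀ᶠ N in atTop, (((List.range N).map e).prod : Equiv.Perm X) x = V x := by
    intro x
    by_cases h : ∃ k, x ∈ D k
    · obtain ⟨k, hk⟩ := h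
      filter_upwards [eventually_gt_atTop k] with N hN
      exact heq N x fun l hl => Set.disjoint_left.1 (hD k l (by omega)) hk
    · exact Eventually.of_forall fun N => heq N x fun k _ hk => h ⟨k, hk⟩
  refine ⟨⟨V, mem_preFullGroup_of_eventually_eq _ V hev⟩, hV, hV', fun N x hx => ?_⟩
  by_contra h
  simp only [mem_iUnion, not_exists] at h
  exact hx (heq N x h)

theorem induced_apply_of_mem {T : PreFullGroup μ R} {A : Set X} {hA : MeasurableSet A}
    {hTA : (T : Equiv.Perm X) ⁻¹' A = A} {x : X} (hx : x ∈ A) :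
    (induced T A hA hTA : Equiv.Perm X) x = (T : Equiv.Perm X) x := if_pos hx

theorem induced_apply_of_notMem {T : PreFullGroup μ R} {A : Set X} {hA : MeasurableSet A}
    {hTA : (T : Equiv.Perm X) ⁻¹' A = A} {x : X} (hx : x ∉ A) :
    (induced T A hA hTA : Equiv.Perm X) x = x := if_neg hx

end General

/-! ### Powers of the glued transformation -/

/-- If `V` is a glueing of `2^k`-th roots of the `U (n k)`, then its `2^K`-th power coincides with
`U (n K)` away from the part of the support of `U (n K)` which has been left out, and away from the
supports of the `U (n k)` with `K < k`. -/
theorem dist_pow_U_le {n : ℕ → ℕ} (hn : StrictMono n) (hn2 : ∀ k, 2 ≤ n k)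
    {ρ : ∀ k, Equiv.Perm (Fin (n k + k) → Bool)} {B : ℕ → Set (ℕ → Bool)}
    (hρ : ∀ k, IsDyadicRoot k (τ (n k)) (ρ k)) (hB : ∀ k, MeasurableSet (B k))
    (hinv : ∀ k, (dyadic (ρ k) : Equiv.Perm (ℕ → Bool)) ⁻¹' B k = B k)
    (hsub : ∀ k, B k ⊆ supp (U (n k))) {V : PreFullGroup cantorMeasure R₀}
    (hV : ∀ k, ∀ x ∈ B k, (V : Equiv.Perm (ℕ → Bool)) x =
      (dyadic (ρ k) : Equiv.Perm (ℕ → Bool)) x)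
    (hV' : ∀ x, (∀ k, x ∉ B k) → (V : Equiv.Perm (ℕ → Bool)) x = x) (K : ℕ) :
    dist (V ^ 2 ^ K) (U (n K)) ≤ cantorMeasure.real (supp (U (n K))) - cantorMeasure.real (B K) +
      2 * 2⁻¹ ^ (n (K + 1) - 1) := by
  have hpow : ∀ k, ∀ x ∈ B k, ((V ^ 2 ^ K : PreFullGroup _ _) : Equiv.Perm (ℕ → Bool)) x =
      ((dyadic (ρ k) ^ 2 ^ K : PreFullGroup _ _) : Equiv.Perm (ℕ → Bool)) x := fun k x hx => by
    rw [Subgroup.coe_pow, Subgroup.coe_pow]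
    refine pow_apply_of_eqOn (hV k) (fun y hy => ?_) _ x hx
    rwa [← mem_preimage, hinv k]
  have hfix : ∀ x, (∀ k, x ∉ B k) →
      ((V ^ 2 ^ K : PreFullGroup _ _) : Equiv.Perm (ℕ → Bool)) x = x := fun x hx => by
    rw [Subgroup.coe_pow]
    have := pow_apply_of_eqOn (f := (V : Equiv.Perm (ℕ → Bool))) (g := 1) (A := {x})
      (by rintro y rfl; exact hV' y hx) (by rintro y rfl; rfl) (2 ^ K) x rfl
    rwa [one_pow] at this
  have hsubset : {x | ((V ^ 2 ^ K : PreFullGroup _ _) : Equiv.Perm (ℕ → Bool)) x ≠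
      (U (n K) : Equiv.Perm (ℕ → Bool)) x} ⊆
      (supp (U (n K)) \ B K) ∪ constInitial (n (K + 1) - 1) := by
    intro x hx
    by_contra hx'
    rw [mem_union, not_or, Set.mem_sdiff, not_and, not_not] at hx'
    refine hx ?_
    by_cases h : ∃ k, x ∈ B k
    · obtain ⟨k, hk⟩ := h
      rw [hpow k x hk]
      rcases lt_trichotomy k K with hkK | rfl | hkK
      · have h1 : x ∉ supp (U (n K)) :=
          Set.disjoint_left.1 (disjoint_supp_U (hn2 k) (hn hkK)) (hsub k hk)
        -- The `2^k`-th power is the involution `U (n k)`, and `K > k` leaves at least one further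
        -- squaring.
        have h2 : dyadic (ρ k) ^ 2 ^ K = 1 := by
          obtain ⟨j, rfl⟩ := Nat.exists_eq_add_of_lt hkK
          have : dyadic (τ (n k)) ^ 2 = 1 := by rw [pow_two]; exact U_mul_self _
          rw [add_assoc, pow_add, pow_mul, (hρ k).pow_eq, pow_succ', pow_mul, this, one_pow]
        rw [h2]
        exact (not_not.1 h1).symm
      · rw [(hρ k).pow_eq]
        rfl
      · refine absurd ?_ hx'.2
        have h1 : n (K + 1) ≤ n k := hn.monotone hkK
        exact constInitial_antitone (by omega) (supp_U_subset _ (hsub k hk))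
    · rw [not_exists] at h
      rw [hfix x h]
      by_contra hne
      exact h K (hx'.1 fun h => hne h.symm)
  rw [dist_def, ← measureReal_sdiff (hsub K) (hB K)]
  refine (measureReal_mono hsubset).trans ((measureReal_union_le _ _).trans ?_)
  exact add_le_add le_rfl (measureReal_constInitial_le _)

/-! ### Choice of the parameters and density -/

theorem exists_uniform_approximation_const : ∃ C : ℕ → ℝ, (∀ n, 0 ≤ C n) ∧
    ∀ n, 1 ≤ n → ∀ (V : PreFullGroup cantorMeasure R₀) (σ : Equiv.Perm (Fin n → Bool)),
      ∃ g ∈ Subgroup.closure {T₀, V}, dist g (dyadic σ) ≤ C n * dist V (U n) := by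
  have h : ∀ n : ℕ, ∃ C : ℝ, 0 ≤ C ∧ (1 ≤ n →
      ∀ (V : PreFullGroup cantorMeasure R₀) (σ : Equiv.Perm (Fin n → Bool)),
        ∃ g ∈ Subgroup.closure {T₀, V}, dist g (dyadic σ) ≤ C * dist V (U n)) := by
    intro n
    by_cases hn : 1 ≤ n
    · obtain ⟨C, hC, h⟩ := exists_uniform_approximation hn
      exact ⟨C, hC, fun _ => h⟩
    · exact ⟨0, le_rfl, fun h => absurd h hn⟩
  choose C hC h using h
  exact ⟨C, hC, h⟩

/-- A strictly increasing sequence starting as far as we wish and growing as fast as we wish. -/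
theorem exists_fast_sequence (C : ℕ → ℝ) {ε : ℝ} (hε : 0 < ε) :
    ∃ n : ℕ → ℕ, StrictMono n ∧ (∀ k, 2 ≤ n k) ∧ 2 * 2⁻¹ ^ (n 0 - 1) < ε ∧
      ∀ k, C (n k) * (2 * 2⁻¹ ^ (n (k + 1) - 1)) ≤ 2⁻¹ ^ n k := by
  have hlim : ∀ c η : ℝ, 0 < η → ∀ N : ℕ, ∃ m, N < m ∧ c * (2 * 2⁻¹ ^ (m - 1)) < η := by
    intro c η hη N
    have h1 : Tendsto (fun m : ℕ => c * (2 * (2⁻¹ : ℝ) ^ m)) atTop (𝓝 (c * (2 * 0))) :=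
      ((tendsto_pow_atTop_nhds_zero_of_lt_one (by norm_num) (by norm_num)).const_mul _).const_mul _
    rw [mul_zero, mul_zero] at h1
    obtain ⟨m, hm, hNm⟩ := ((h1.eventually_lt_const hη).and (eventually_ge_atTop N)).exists
    exact ⟨m + 1, by omega, by simpa using hm⟩
  obtain ⟨N, hN, hNε⟩ := hlim 1 ε hε 2
  -- The next index depends only on the current one, so the sequence is an orbit of `F`.
  choose F hF hF' using fun m : ℕ => hlim (C m) (2⁻¹ ^ m) (by positivity) m
  have hs : ∀ k, F^[k + 1] N = F (F^[k] N) := fun k => Function.iterate_succ_apply' F k N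
  have hmono : StrictMono fun k => F^[k] N := strictMono_nat_of_lt_succ fun k => by
    rw [hs]
    exact hF _
  refine ⟨fun k => F^[k] N, hmono, fun k => ?_, by simpa using hNε, fun k => ?_⟩
  · exact hN.le.trans (hmono.monotone (Nat.zero_le k))
  · simp only [hs]
    exact (hF' _).le

/-- Approximating the elements `U (n k)` fast enough yields topological generators. -/
theorem dense_closure_of_dist_pow_le {C : ℕ → ℝ}
    (hCU : ∀ n, 1 ≤ n → ∀ (V : PreFullGroup cantorMeasure R₀) (σ : Equiv.Perm (Fin n → Bool)),
      ∃ g ∈ Subgroup.closure {T₀, V}, dist g (dyadic σ) ≤ C n * dist V (U n))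
    {n : ℕ → ℕ} (hn : StrictMono n) (hn2 : ∀ k, 2 ≤ n k) {V : PreFullGroup cantorMeasure R₀}
    {p : ℕ → ℕ} (hV : ∀ k, C (n k) * dist (V ^ p k) (U (n k)) ≤ 2 * 2⁻¹ ^ n k) :
    Dense (Subgroup.closure {T₀, V} : Set (PreFullGroup cantorMeasure R₀)) := by
  intro T
  rw [Metric.mem_closure_iff]
  intro η hη
  obtain ⟨M, hM⟩ := exists_dist_dyadic_lt T (half_pos hη)
  have hlim : Tendsto (fun k => 2 * (2⁻¹ : ℝ) ^ n k) atTop (𝓝 (2 * 0)) :=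
    ((tendsto_pow_atTop_nhds_zero_of_lt_one (by norm_num) (by norm_num)).comp
      hn.tendsto_atTop).const_mul _
  rw [mul_zero] at hlim
  obtain ⟨k, hk, hMk⟩ := ((hlim.eventually_lt_const (half_pos hη)).and
    (hn.tendsto_atTop.eventually_ge_atTop M)).exists
  obtain ⟨σ, hσ⟩ := hM (n k) hMk
  -- The approximation is applied to the power `V ^ p k`, which belongs to the group generated by
  -- `V`.
  obtain ⟨g, hg, hgσ⟩ := hCU (n k) (by have := hn2 k; omega) (V ^ p k) σ
  refine ⟨g, ?_, ?_⟩
  · refine (Subgroup.closure_le _).2 ?_ hg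
    rintro x (rfl | rfl)
    · exact Subgroup.subset_closure (by simp)
    · exact pow_mem (Subgroup.subset_closure (by simp)) _
  · have := dist_triangle T (dyadic σ) g
    rw [dist_comm (dyadic σ)] at this
    have := hV k
    linarith

theorem dense_closure_toFull {X : Type*} [MeasurableSpace X] {μ : Measure X} [IsFiniteMeasure μ]
    {R : Setoid X} {S T : PreFullGroup μ R}
    (h : Dense (Subgroup.closure {S, T} : Set (PreFullGroup μ R))) :
    Dense (Subgroup.closure {toFull S, toFull T} : Set (FullGroup μ R)) := by
  have := SeparationQuotient.surjective_mk.denseRange.dense_image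
    SeparationQuotient.continuous_mk h
  have e : Subgroup.closure {toFull S, toFull T} =
      (Subgroup.closure {S, T}).map (SeparationQuotient.mkMonoidHom (M := PreFullGroup μ R)) := by
    rw [MonoidHom.map_closure, image_pair]
    rfl
  rw [e]
  exact this

end DyadicFullGroup

/-! ### The theorem -/

theorem theorem5p3 (ε : ℝ) (hε : 0 < ε) :
    ∃ (n : ℕ → ℕ) (δ : ℕ → ℝ), StrictMono n ∧ (∀ k, 2 ≤ n k) ∧ (∀ k, 0 < δ k) ∧
      ∀ (ρ : ∀ k, Equiv.Perm (Fin (n k + k) → Bool)) (B : ℕ → Set (ℕ → Bool))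
        (_ : ∀ k, IsDyadicRoot k (τ (n k)) (ρ k))
        (hB : ∀ k, MeasurableSet (B k))
        (hinv : ∀ k, (dyadic (ρ k) : Equiv.Perm (ℕ → Bool)) ⁻¹' B k = B k)
        (_ : ∀ k, B k ⊆ supp (U (n k)))
        (_ : ∀ k, cantorMeasure.real (supp (U (n k))) - δ k < cantorMeasure.real (B k)),
        ∃ V : PreFullGroup cantorMeasure R₀,
          Tendsto
            (fun N => toFull
              ((List.range N).map fun k => induced (dyadic (ρ k)) (B k) (hB k) (hinv k)).prod)
            atTop (𝓝 (toFull V)) ∧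
          Dense (Subgroup.closure {toFull T₀, toFull V} : Set (FullGroup cantorMeasure R₀)) ∧
          cantorMeasure.real (supp V) < ε := by
  obtain ⟨C, hC, hCU⟩ := exists_uniform_approximation_const
  obtain ⟨n, hn, hn2, hn0, hnC⟩ := exists_fast_sequence C hε
  -- This `δ k` satisfies `C (n k) * δ k ≤ 2⁻¹ ^ n k`; the `+ 1` guards against `C (n k) = 0`. The
  -- omitted part of `supp (U (n k))` and the later factors thus cost `2⁻¹ ^ n k` each.
  refine ⟨n, fun k => 2⁻¹ ^ n k / (C (n k) + 1), hn, hn2,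
    fun k => div_pos (by positivity) (by linarith [hC (n k)]), ?_⟩
  intro ρ B hρ hB hinv hsub hδ
  have hdisj : ∀ k l, k ≠ l → Disjoint (B k) (B l) := by
    intro k l hkl
    rcases lt_or_gt_of_ne hkl with h | h
    · exact (disjoint_supp_U (hn2 k) (hn h)).mono (hsub k) (hsub l)
    · exact (disjoint_supp_U (hn2 l) (hn h)).symm.mono (hsub k) (hsub l)
  have htail : ∀ N k, N ≤ k → B k ⊆ constInitial (n N - 1) := fun N k hk =>
    ((hsub k).trans (supp_U_subset _)).trans
      (constInitial_antitone (Nat.sub_le_sub_right (hn.monotone hk) 1))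
  obtain ⟨V, hV, hV', hVN⟩ := exists_infinite_product
    (fun k => induced (dyadic (ρ k)) (B k) (hB k) (hinv k)) B hdisj
    (fun k x => by
      by_cases hx : x ∈ B k
      · rw [induced_apply_of_mem hx, ← mem_preimage, hinv k]
      · rw [induced_apply_of_notMem hx])
    (fun k x hx => induced_apply_of_notMem hx)
  have hVρ : ∀ k, ∀ x ∈ B k, (V : Equiv.Perm (ℕ → Bool)) x =
      (dyadic (ρ k) : Equiv.Perm (ℕ → Bool)) x := fun k x hx => by
    rw [hV k x hx, induced_apply_of_mem hx]
  refine ⟨V, ?_, ?_, ?_⟩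
  · refine (SeparationQuotient.continuous_mk.tendsto V).comp ?_
    rw [tendsto_iff_dist_tendsto_zero]
    have hlim : Tendsto (fun N => 2 * (2⁻¹ : ℝ) ^ (n N - 1)) atTop (𝓝 (2 * 0)) :=
      ((tendsto_pow_atTop_nhds_zero_of_lt_one (by norm_num) (by norm_num)).comp
        ((tendsto_sub_atTop_nat 1).comp hn.tendsto_atTop)).const_mul _
    rw [mul_zero] at hlim
    refine squeeze_zero (fun _ => dist_nonneg) (fun N => ?_) hlim
    rw [dist_def]
    exact (measureReal_mono ((hVN N).trans (iUnion₂_subset fun k hk => htail N k hk))).trans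
      (measureReal_constInitial_le _)
  · refine dense_closure_toFull (dense_closure_of_dist_pow_le hCU hn hn2
      (p := fun k => 2 ^ k) fun k => ?_)
    have h1 := dist_pow_U_le hn hn2 hρ hB hinv hsub hVρ hV' k
    have h2 := hδ k
    have h3 : C (n k) * (2⁻¹ ^ n k / (C (n k) + 1)) ≤ 2⁻¹ ^ n k := by
      have hp : (0 : ℝ) < 2⁻¹ ^ n k := by positivity
      rw [mul_div_assoc', div_le_iff₀ (by linarith [hC (n k)])]
      nlinarith
    calc C (n k) * dist (V ^ 2 ^ k) (U (n k))
        ≤ C (n k) * (2⁻¹ ^ n k / (C (n k) + 1) + 2 * 2⁻¹ ^ (n (k + 1) - 1)) :=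
          mul_le_mul_of_nonneg_left (by linarith) (hC _)
      _ ≤ 2 * 2⁻¹ ^ n k := by
          rw [mul_add]
          linarith [hnC k]
  · refine (measureReal_mono fun x hx => ?_).trans_lt
      ((measureReal_constInitial_le (n 0 - 1)).trans_lt hn0)
    by_contra h
    exact hx (hV' x fun k hk => h (htail 0 k (Nat.zero_le k) hk))
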